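/- Let $\gamma>0$ and $T>0$, and let $G:(0,\infty)\to[0,\infty)$ be continuous, nonincreasing and nonconstant, with $\int_0^S G(t)\,dt<\infty$ for every $S>0$. For $\phi\in L^2[0,T]$ put $$J_\gamma[\phi]=\frac{\gamma}{2}\int_0^T\phi(t)^2\,dt+\frac12\int_0^T\int_0^T G(|t-s|)\,\phi(t)\phi(s)\,dt\,ds,$$ and let $\Phi_1$ be the set of all $\phi\in L^2[0,T]$ with $\int_0^T\phi(t)\,dt=1$ for which the double integral is well defined and finite, i.e. for which $(t,s)\mapsto G(|t-s|)\phi(t)\phi(s)$ is Lebesgue integrable on $[0,T]^2$. If $G$ is convex on $(0,T]$, then $J_\gamma$ has a unique minimizer over $\Phi_1$ (as an element of $L^2[0,T]$, i.e. up to equality almost everywhere), and this minimizer is a probability density on $[0,T]$: it is nonnegative almost everywhere and has integral $1$. -/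

import Mathlib

open MeasureTheory Set

/-- Lebesgue measure on the interval `[0,T]`. -/
noncomputable abbrev lebesgueIcc (T : ℝ) : Measure ℝ :=
  (volume : Measure ℝ).restrict (Icc 0 T)

/-- The real Hilbert space `L²[0,T]` (functions modulo a.e. equality). -/
abbrev L2Icc (T : ℝ) : Type :=
  Lp ℝ 2 (lebesgueIcc T)

/-- Standing assumption on the kernel: `G : (0,∞) → [0,∞)` is continuous, nonincreasing,
nonconstant, and integrable on `(0,S]` for every `S > 0`. Values of `G` outside `(0,∞)` are
unconstrained. -/
structure IsDecreasingKernel (G : ℝ → ℝ) : Prop where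
  nonneg : ∀ t ∈ Ioi (0 : ℝ), 0 ≤ G t
  continuousOn : ContinuousOn G (Ioi 0)
  antitoneOn : AntitoneOn G (Ioi 0)
  nonconstant : ∃ s ∈ Ioi (0 : ℝ), ∃ t ∈ Ioi (0 : ℝ), G s ≠ G t
  integrableOn : ∀ S : ℝ, 0 < S → IntegrableOn G (Ioc 0 S)

/-- The energy functional
`J_γ[φ] = γ/2 ∫₀ᵀ φ(t)² dt + 1/2 ∫₀ᵀ ∫₀ᵀ G(|t-s|) φ(t) φ(s) dt ds`. The diagonal `t = s` is a
Lebesgue null set, so the value `G 0` plays no role. -/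
noncomputable def energy (γ T : ℝ) (G : ℝ → ℝ) (φ : L2Icc T) : ℝ :=
  γ / 2 * (∫ t in Icc 0 T, φ t ^ 2) +
    1 / 2 * (∫ s in Icc 0 T, (∫ t in Icc 0 T, G |t - s| * φ t * φ s))

/-- The constraint set `Φ₁`: all `φ ∈ L²[0,T]` with `∫₀ᵀ φ = 1` for which the double integral in
the energy is well defined and finite. -/
def constraintSet (T : ℝ) (G : ℝ → ℝ) : Set (L2Icc T) :=
  {φ | ∫ t in Icc 0 T, φ t = 1 ∧
    Integrable (fun p : ℝ × ℝ => G |p.1 - p.2| * φ p.1 * φ p.2)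
      ((lebesgueIcc T).prod (lebesgueIcc T))}

/-- `φ` minimizes `J_γ` over `Φ₁`. -/
def IsEnergyMinimizer (γ T : ℝ) (G : ℝ → ℝ) (φ : L2Icc T) : Prop :=
  φ ∈ constraintSet T G ∧ ∀ ψ ∈ constraintSet T G, energy γ T G φ ≤ energy γ T G ψ

/-- `φ` is a probability density on `[0,T]`. -/
def IsProbabilityDensity (T : ℝ) (φ : ℝ → ℝ) : Prop :=
  (∀ᵐ t ∂(lebesgueIcc T), 0 ≤ φ t) ∧ Integrable φ (lebesgueIcc T) ∧ ∫ t in Icc 0 T, φ t = 1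

/-! Let B be the bilinear form with J = B(φ,φ)/2, and call t ↦ ∫ G(|t-s|) φ(s) ds the potential of
φ.

Convexity makes the kernel positive semidefinite. The function h = -G' (right derivative) is
nonnegative and nonincreasing, and G(t) - G(T) is the integral of h over (t,T). Slicing h
horizontally writes G as the nonnegative constant G(T) plus a mixture of triangles (m - t)⁺. Each
triangle kernel is the overlap length of two windows, hence an integral of rank-one squares. The
term γ‖φ‖² then makes B coercive, and Schur's test makes it bounded.

The sign constraint is imposed at first and then shown not to bind. The minimizer φ of B over the
closed convex set of densities has gradient w = γφ + potential satisfying w ≥ c, with equality where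
φ ≠ 0; there the potential is c - γφ ≤ c. The maximum principle `potential_le_of_le_on_support`
extends the bound potential ≤ c to all of [0,T], so w ≤ c also where φ = 0. Hence w = c almost
everywhere, which is the Euler-Lagrange equation without sign constraint, and coercivity makes φ the
unique minimizer over Φ₁. -/

/-! ### Positive semidefiniteness of convex kernels -/

/-- Mixtures of positive semidefinite kernels are positive semidefinite. -/
lemma integral_mixture_nonneg {α β : Type*} [MeasurableSpace α] [MeasurableSpace β]
    {ν : Measure α} {ρ : Measure β} [SFinite ν] [SFinite ρ] {τ : α → β → ℝ} {k u : β → ℝ}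
    (hτ : AEStronglyMeasurable (fun q : α × β => τ q.1 q.2) (ν.prod ρ))
    (hτ0 : ∀ a b, 0 ≤ τ a b) (hint : ∀ᵐ b ∂ρ, Integrable (fun a => τ a b) ν)
    (hk : ∀ᵐ b ∂ρ, ∫ a, τ a b ∂ν = k b) (hu : AEStronglyMeasurable u ρ)
    (hku : Integrable (fun b => k b * u b) ρ)
    (hpos : ∀ a, 0 ≤ ∫ b, τ a b * u b ∂ρ) :
    0 ≤ ∫ b, k b * u b ∂ρ := by
  -- As τ ≥ 0, integrating |τ u| over the mixing variable gives |k u|, so integrability of k u alone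
  -- justifies Fubini.
  have hF : Integrable (fun q : α × β => τ q.1 q.2 * u q.2) (ν.prod ρ) := by
    refine (integrable_prod_iff' (hτ.mul hu.comp_snd)).2 ⟨?_, ?_⟩
    · filter_upwards [hint] with b hb using hb.mul_const (u b)
    · refine hku.norm.congr ?_
      filter_upwards [hk] with b hb
      have : ∀ a, ‖τ a b * u b‖ = τ a b * ‖u b‖ := fun a => by
        rw [norm_mul, Real.norm_of_nonneg (hτ0 a b)]
      simp only [Pi.mul_apply, this, integral_mul_const, hb]
      rw [norm_mul, Real.norm_of_nonneg]
      rw [← hb]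
      exact integral_nonneg fun a => hτ0 a b
  have h1 : ∫ b, k b * u b ∂ρ = ∫ b, ∫ a, τ a b * u b ∂ν ∂ρ := by
    refine integral_congr_ae ?_
    filter_upwards [hk] with b hb
    rw [integral_mul_const, hb]
  rw [h1, ← integral_integral_swap hF]
  exact integral_nonneg hpos

/-- Both points lie in the window (x, x + m) exactly when max(t,s) - m < x < min(t,s), an interval
of length (m - |t - s|)⁺. This exhibits the triangle kernel as a mixture of rank-one kernels. -/
lemma volume_real_window (m t s : ℝ) :
    (∫ x : ℝ, (Ioo x (x + m)).indicator (fun _ => (1 : ℝ)) t *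
      (Ioo x (x + m)).indicator (fun _ => (1 : ℝ)) s) = max (m - |t - s|) 0 ∧
    Integrable (fun x : ℝ => (Ioo x (x + m)).indicator (fun _ => (1 : ℝ)) t *
      (Ioo x (x + m)).indicator (fun _ => (1 : ℝ)) s) := by
  have h : (fun x : ℝ => (Ioo x (x + m)).indicator (fun _ => (1 : ℝ)) t *
      (Ioo x (x + m)).indicator (fun _ => (1 : ℝ)) s) =
      (Ioo (max t s - m) (min t s)).indicator (fun _ => (1 : ℝ)) := by
    funext x
    simp only [indicator_apply, mem_Ioo, sub_lt_iff_lt_add, max_lt_iff, lt_min_iff]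
    split_ifs <;> grind
  rw [h]
  refine ⟨?_, ?_⟩
  · rw [integral_indicator_const _ measurableSet_Ioo, Real.volume_real_Ioo]
    simp only [smul_eq_mul, mul_one]
    congr 1
    rcases le_total t s with h | h
    · rw [max_eq_right h, min_eq_left h, abs_of_nonpos (by linarith)]; ring
    · rw [max_eq_left h, min_eq_right h, abs_of_nonneg (by linarith)]; ring
  · exact (integrable_indicator_iff measurableSet_Ioo).2 (by simp [IntegrableOn])

/-- The triangle kernel is positive semidefinite. -/
lemma integral_triangle_nonneg {μ : Measure ℝ} [IsFiniteMeasure μ] {f : ℝ → ℝ}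
    (hf : Integrable f μ) (m : ℝ) :
    0 ≤ ∫ p : ℝ × ℝ, max (m - |p.1 - p.2|) 0 * (f p.1 * f p.2) ∂(μ.prod μ) := by
  have huu : Integrable (fun p : ℝ × ℝ => f p.1 * f p.2) (μ.prod μ) := hf.mul_prod hf
  refine integral_mixture_nonneg (ν := volume)
    (τ := fun x p => (Ioo x (x + m)).indicator (fun _ => (1 : ℝ)) p.1 *
      (Ioo x (x + m)).indicator (fun _ => (1 : ℝ)) p.2) ?_ ?_ ?_ ?_ huu.1 ?_ ?_
  · have hm : MeasurableSet {q : ℝ × ℝ | q.2 ∈ Ioo q.1 (q.1 + m)} :=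
      (measurableSet_lt measurable_fst measurable_snd).inter
        (measurableSet_lt measurable_snd (measurable_fst.add_const m))
    have h1 : Measurable (fun q : ℝ × ℝ => (Ioo q.1 (q.1 + m)).indicator (fun _ => (1 : ℝ)) q.2) :=
      (measurable_const (a := (1 : ℝ))).indicator hm
    exact ((h1.comp (measurable_fst.prodMk (measurable_fst.comp measurable_snd))).mul
      (h1.comp (measurable_fst.prodMk (measurable_snd.comp measurable_snd)))).aestronglyMeasurable
  · intro x p
    exact mul_nonneg (indicator_nonneg (fun _ _ => zero_le_one) _)
      (indicator_nonneg (fun _ _ => zero_le_one) _)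
  · exact .of_forall fun p => (volume_real_window m p.1 p.2).2
  · exact .of_forall fun p => (volume_real_window m p.1 p.2).1
  · refine huu.bdd_mul (c := max m 0) ?_ ?_
    · exact Continuous.aestronglyMeasurable (by fun_prop)
    · refine .of_forall fun p => ?_
      rw [Real.norm_of_nonneg (le_max_right _ _)]
      exact max_le_max (by linarith [abs_nonneg (p.1 - p.2)]) le_rfl
  · intro x
    have : ∀ p : ℝ × ℝ, (Ioo x (x + m)).indicator (fun _ => (1 : ℝ)) p.1 *
        (Ioo x (x + m)).indicator (fun _ => (1 : ℝ)) p.2 * (f p.1 * f p.2) =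
        ((Ioo x (x + m)).indicator (fun _ => (1 : ℝ)) p.1 * f p.1) *
        ((Ioo x (x + m)).indicator (fun _ => (1 : ℝ)) p.2 * f p.2) := fun p => by ring
    simp only [this]
    rw [integral_prod_mul (fun t => (Ioo x (x + m)).indicator (fun _ => (1 : ℝ)) t * f t)
      (fun t => (Ioo x (x + m)).indicator (fun _ => (1 : ℝ)) t * f t)]
    exact mul_self_nonneg _

/-- The superlevel sets of a nonincreasing function on `(0,T)` are intervals starting at `0`. -/
lemma volume_superlevel_Ioo {h : ℝ → ℝ} {T t : ℝ} (hh : AntitoneOn h (Ioo 0 T)) (y : ℝ)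
    (ht : 0 < t) :
    (volume.restrict (Ioo t T)).real {u | y < h u} =
      max (volume.real {u ∈ Ioo 0 T | y < h u} - t) 0 := by
  have hm : ∀ a, 0 ≤ a → MeasurableSet {u ∈ Ioo a T | y < h u} := by
    intro a ha
    refine OrdConnected.measurableSet ⟨fun u hu v hv w hw => ⟨⟨hu.1.1.trans_le hw.1,
      hw.2.trans_lt hv.1.2⟩, hv.2.trans_le (hh ⟨?_, ?_⟩ ⟨?_, ?_⟩ hw.2)⟩⟩
    · exact ha.trans_lt (hu.1.1.trans_le hw.1)
    · exact hw.2.trans_lt hv.1.2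
    · exact ha.trans_lt hv.1.1
    · exact hv.1.2
  have hr : (volume.restrict (Ioo t T)).real {u | y < h u} =
      volume.real {u ∈ Ioo t T | y < h u} := by
    rw [measureReal_def, Measure.restrict_apply' measurableSet_Ioo, measureReal_def, inter_comm]
    rfl
  rw [hr]
  by_cases hex : ∃ u ∈ Ioo t T, y < h u
  · obtain ⟨u, hu, hyu⟩ := hex
    -- By monotonicity, one point of the superlevel set beyond t forces all of (0,t] into it.
    have hsplit : {u ∈ Ioo 0 T | y < h u} = Ioc 0 t ∪ {u ∈ Ioo t T | y < h u} := by
      ext v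
      simp only [mem_union, mem_Ioc, mem_ofPred_eq, mem_Ioo]
      constructor
      · rintro ⟨⟨h1, h2⟩, h3⟩
        rcases le_or_gt v t with h | h
        · exact .inl ⟨h1, h⟩
        · exact .inr ⟨⟨h, h2⟩, h3⟩
      · rintro (⟨h1, h2⟩ | ⟨⟨h1, h2⟩, h3⟩)
        · have hvu : v < u := h2.trans_lt hu.1
          exact ⟨⟨h1, hvu.trans hu.2⟩, hyu.trans_le
            (hh ⟨h1, hvu.trans hu.2⟩ ⟨ht.trans hu.1, hu.2⟩ hvu.le)⟩
        · exact ⟨⟨ht.trans h1, h2⟩, h3⟩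
    have hfin : volume {u ∈ Ioo t T | y < h u} ≠ ⊤ :=
      measure_ne_top_of_subset (fun v hv => hv.1) (measure_Ioo_lt_top (μ := volume) (a := t) (b := T)).ne
    rw [hsplit, measureReal_union _ (hm t ht.le) (by simp) hfin, Real.volume_real_Ioc_of_le ht.le,
      max_eq_left]
    · ring
    · have := measureReal_nonneg (μ := volume) (s := {u ∈ Ioo t T | y < h u})
      linarith
    · refine disjoint_left.2 fun v h1 h2 => ?_
      exact absurd h2.1.1 (not_lt.2 h1.2)
  · push Not at hex
    have he : {u ∈ Ioo t T | y < h u} = ∅ := by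
      ext u; simp only [mem_ofPred_eq, mem_empty_iff_false, iff_false, not_and, not_lt]
      exact hex u
    rw [he, measureReal_empty, max_eq_right]
    have : {u ∈ Ioo 0 T | y < h u} ⊆ Ioc 0 t := by
      intro u hu
      refine ⟨hu.1.1, ?_⟩
      by_contra hc
      exact absurd hu.2 (not_lt.2 (hex u ⟨not_le.1 hc, hu.1.2⟩))
    have := measureReal_mono (μ := volume) this (by simp)
    rw [Real.volume_real_Ioc_of_le ht.le] at this
    linarith

/-- A convex nonincreasing function on `(0,T]` is a constant plus a mixture of triangles. -/
lemma exists_triangle_mixture {G : ℝ → ℝ} {T : ℝ} (hcont : ContinuousOn G (Ioc 0 T))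
    (hanti : AntitoneOn G (Ioc 0 T)) (hconv : ConvexOn ℝ (Ioc 0 T) G) :
    ∃ m : ℝ → ℝ, Measurable m ∧ ∀ t ∈ Ioc 0 T,
      Integrable (fun y => max (m y - t) 0) (volume.restrict (Ioi 0)) ∧
      ∫ y in Ioi 0, max (m y - t) 0 = G t - G T := by
  set h : ℝ → ℝ := fun u => -derivWithin G (Ioi u) u with hdef
  have hint : interior (Ioc (0 : ℝ) T) = Ioo 0 T := interior_Ioc
  have hh : AntitoneOn h (Ioo 0 T) := by
    intro a ha b hb hab
    exact neg_le_neg (hconv.monotoneOn_rightDeriv (hint ▸ ha) (hint ▸ hb) hab)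
  have hder : ∀ u ∈ Ioo 0 T, HasDerivWithinAt (fun x => -G x) (h u) (Ioi u) u := fun u hu =>
    (hconv.hasDerivWithinAt_rightDeriv_of_mem_interior (hint ▸ hu)).neg
  have h0 : ∀ u ∈ Ioo 0 T, 0 ≤ h u := by
    intro u hu
    have hT : T ∈ Ioc 0 T := ⟨hu.1.trans hu.2, le_rfl⟩
    have h1 := hconv.rightDeriv_le_slope_of_mem_interior (hint ▸ hu) hT hu.2
    have h2 : slope G u T ≤ 0 := by
      rw [slope_def_field]
      exact div_nonpos_of_nonpos_of_nonneg
        (sub_nonpos.2 (hanti ⟨hu.1, hu.2.le⟩ hT hu.2.le)) (sub_nonneg.2 hu.2.le)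
    exact neg_nonneg.2 (h1.trans h2)
  -- The superlevel set {h > y} is an interval starting at 0, and m y is its length; its part beyond
  -- t has length (m y - t)⁺.
  set m : ℝ → ℝ := fun y => volume.real {u ∈ Ioo 0 T | y < h u} with hm
  have hmanti : Antitone m := fun y y' hyy => measureReal_mono
    (fun u hu => ⟨hu.1, hyy.trans_lt hu.2⟩)
    (measure_ne_top_of_subset (fun v hv => hv.1)
      (measure_Ioo_lt_top (μ := volume) (a := 0) (b := T)).ne)
  refine ⟨m, hmanti.measurable, fun t ht => ?_⟩
  have hsub : Icc t T ⊆ Ioc 0 T := fun u hu => ⟨ht.1.trans_le hu.1, hu.2⟩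
  have hsub' : Ioo t T ⊆ Ioo 0 T := fun u hu => ⟨ht.1.trans hu.1, hu.2⟩
  have hci : IntegrableOn h (Ioc t T) :=
    intervalIntegral.integrableOn_deriv_right_of_nonneg (hcont.neg.mono hsub)
      (fun u hu => hder u (hsub' hu)) (fun u hu => h0 u (hsub' hu))
  have hFTC : ∫ u in t..T, h u = (-G T) - (-G t) :=
    intervalIntegral.integral_eq_sub_of_hasDeriv_right_of_le ht.2 (hcont.neg.mono hsub)
      (fun u hu => hder u (hsub' hu)) ((intervalIntegrable_iff_integrableOn_Ioc_of_le ht.2).2 hci)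
  rw [intervalIntegral.integral_of_le ht.2, integral_Ioc_eq_integral_Ioo] at hFTC
  have hci' : Integrable h (volume.restrict (Ioo t T)) := hci.mono_set Ioo_subset_Ioc_self
  have hnn : 0 ≤ᵐ[volume.restrict (Ioo t T)] h := by
    filter_upwards [ae_restrict_mem measurableSet_Ioo] with u hu using h0 u (hsub' hu)
  -- Layer cake: the integral of h over (t,T), which is G t - G T, equals the integral over y > 0 of
  -- the lengths of these parts.
  have hlc := lintegral_eq_lintegral_meas_lt _ hnn hci'.aemeasurable
  have hco : ∀ y, (volume.restrict (Ioo t T)) {u | y < h u} = ENNReal.ofReal (max (m y - t) 0) := by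
    intro y
    rw [← volume_superlevel_Ioo hh y ht.1, ofReal_measureReal]
  simp only [hco] at hlc
  have hmeas : Measurable fun y => max (m y - t) 0 :=
    (hmanti.measurable.sub_const t).max measurable_const
  have hmnn : 0 ≤ᵐ[volume.restrict (Ioi 0)] fun y => max (m y - t) 0 :=
    .of_forall fun y => le_max_right _ _
  have hi : Integrable (fun y => max (m y - t) 0) (volume.restrict (Ioi 0)) := by
    refine ⟨hmeas.aestronglyMeasurable, ?_⟩
    rw [hasFiniteIntegral_iff_ofReal hmnn, ← hlc]
    exact hci'.lintegral_lt_top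
  refine ⟨hi, ?_⟩
  rw [integral_eq_lintegral_of_nonneg_ae hmnn
    hmeas.aestronglyMeasurable, ← hlc, ← integral_eq_lintegral_of_nonneg_ae hnn hci'.1, hFTC]
  ring

/-- The diagonal is null, so the value of G at 0 never matters and identities valid on (0,T]
suffice. -/
lemma ae_prod_lebesgueIcc_abs_sub (T : ℝ) :
    ∀ᵐ p : ℝ × ℝ ∂(lebesgueIcc T).prod (lebesgueIcc T), |p.1 - p.2| ∈ Ioc 0 T := by
  have h1 : ∀ᵐ p : ℝ × ℝ ∂(lebesgueIcc T).prod (lebesgueIcc T), p ∈ Icc 0 T ×ˢ Icc 0 T := by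
    rw [Measure.prod_restrict]
    exact ae_restrict_mem (measurableSet_Icc.prod measurableSet_Icc)
  have h2 : ∀ᵐ p : ℝ × ℝ ∂(lebesgueIcc T).prod (lebesgueIcc T), p.1 ≠ p.2 := by
    have hms : MeasurableSet {p : ℝ × ℝ | p.1 ≠ p.2} :=
      (measurableSet_eq_fun measurable_fst measurable_snd).compl
    refine (Measure.ae_prod_iff_ae_ae hms).2 (.of_forall fun x => ?_)
    filter_upwards [Measure.ae_ne (lebesgueIcc T) x] with y hy using hy.symm
  filter_upwards [h1, h2] with p hp hne
  refine ⟨abs_pos.2 (sub_ne_zero.2 hne), abs_le.2 ⟨?_, ?_⟩⟩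
  · linarith [hp.1.1, hp.2.2]
  · linarith [hp.1.2, hp.2.1]

/-- Convex nonincreasing nonnegative kernels are positive semidefinite. -/
lemma integral_convex_kernel_nonneg {G : ℝ → ℝ} {T : ℝ}
    (hcont : ContinuousOn G (Ioc 0 T)) (hanti : AntitoneOn G (Ioc 0 T))
    (hconv : ConvexOn ℝ (Ioc 0 T) G) (hGT : 0 ≤ G T) {f : ℝ → ℝ}
    (hf : Integrable f (lebesgueIcc T))
    (hGf : Integrable (fun p : ℝ × ℝ => G |p.1 - p.2| * (f p.1 * f p.2))
      ((lebesgueIcc T).prod (lebesgueIcc T))) :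
    0 ≤ ∫ p : ℝ × ℝ, G |p.1 - p.2| * (f p.1 * f p.2)
      ∂((lebesgueIcc T).prod (lebesgueIcc T)) := by
  obtain ⟨m, hm, hmix⟩ := exists_triangle_mixture hcont hanti hconv
  have huu : Integrable (fun p : ℝ × ℝ => f p.1 * f p.2)
    ((lebesgueIcc T).prod (lebesgueIcc T)) := hf.mul_prod hf
  have hdiff : Integrable (fun p : ℝ × ℝ => (G |p.1 - p.2| - G T) * (f p.1 * f p.2))
      ((lebesgueIcc T).prod (lebesgueIcc T)) := by
    simp only [sub_mul]
    exact hGf.sub (huu.const_mul _)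
  have key : 0 ≤ ∫ p : ℝ × ℝ, (G |p.1 - p.2| - G T) * (f p.1 * f p.2)
      ∂((lebesgueIcc T).prod (lebesgueIcc T)) := by
    refine integral_mixture_nonneg (ν := volume.restrict (Ioi 0))
      (τ := fun y p => max (m y - |p.1 - p.2|) 0) ?_ (fun _ _ => le_max_right _ _) ?_ ?_ huu.1
      hdiff (fun y => integral_triangle_nonneg hf (m y))
    · refine Measurable.aestronglyMeasurable ?_
      have h1 : Measurable fun q : ℝ × ℝ × ℝ => |q.2.1 - q.2.2| :=
        Continuous.measurable (by fun_prop)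
      exact ((hm.comp measurable_fst).sub h1).max measurable_const
    · filter_upwards [ae_prod_lebesgueIcc_abs_sub T] with p hp using (hmix _ hp).1
    · filter_upwards [ae_prod_lebesgueIcc_abs_sub T] with p hp using (hmix _ hp).2
  -- The constant part of the kernel contributes G(T)(∫ f)² ≥ 0.
  have heq : ∫ p : ℝ × ℝ, G |p.1 - p.2| * (f p.1 * f p.2)
      ∂((lebesgueIcc T).prod (lebesgueIcc T)) =
      (∫ p : ℝ × ℝ, (G |p.1 - p.2| - G T) * (f p.1 * f p.2)
        ∂((lebesgueIcc T).prod (lebesgueIcc T))) + G T * ((∫ x, f x ∂(lebesgueIcc T)) *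
        ∫ x, f x ∂(lebesgueIcc T)) := by
    rw [← integral_prod_mul, ← integral_const_mul, ← integral_add hdiff (huu.const_mul _)]
    refine integral_congr_ae (.of_forall fun p => ?_)
    simp only
    ring
  rw [heq]
  exact add_nonneg key (mul_nonneg hGT (mul_self_nonneg _))

/-! ### Minimization of coercive forms over convex sets -/

/-- A bounded coercive symmetric bilinear form on a Banach space has a minimizer on each nonempty
closed convex set, characterized by a variational inequality. -/
lemma exists_variational_inequality {H : Type*} [NormedAddCommGroup H] [NormedSpace ℝ H]
    [CompleteSpace H] (b : LinearMap.BilinForm ℝ H) (hsymm : ∀ x y, b x y = b y x)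
    {c C : ℝ} (hc : 0 < c) (hlow : ∀ x, c * ‖x‖ ^ 2 ≤ b x x) (hup : ∀ x, b x x ≤ C * ‖x‖ ^ 2)
    {K : Set H} (hne : K.Nonempty) (hclosed : IsClosed K) (hconv : Convex ℝ K) :
    ∃ x ∈ K, ∀ y ∈ K, 0 ≤ b x (y - x) := by
  have hpos : ∀ x, 0 ≤ b x x := fun x => le_trans (by positivity) (hlow x)
  have hC : ∀ x : H, 0 ≤ C * ‖x‖ ^ 2 := fun x => (hpos x).trans (hup x)
  -- Cauchy-Schwarz for b turns the bound on the diagonal into boundedness of the form.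
  have hcs : ∀ x y, ‖b x y‖ ≤ |C| * ‖x‖ * ‖y‖ := by
    intro x y
    have h1 : b x y ^ 2 ≤ b x x * b y y := by
      have := LinearMap.BilinForm.apply_mul_apply_le_of_forall_zero_le b hpos x y
      rw [hsymm y x] at this
      nlinarith
    have h2 : b x x * b y y ≤ (C * ‖x‖ ^ 2) * (C * ‖y‖ ^ 2) :=
      mul_le_mul (hup x) (hup y) (hpos y) (hC x)
    rw [Real.norm_eq_abs]
    refine abs_le_of_sq_le_sq (h1.trans (h2.trans (le_of_eq ?_))) (by positivity)
    rw [mul_pow, mul_pow, sq_abs]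
    ring
  let bc : H →L[ℝ] H →L[ℝ] ℝ := LinearMap.mkContinuous₂ b |C| hcs
  have hq : Continuous fun x => b x x := by
    have : Continuous fun x => bc x x := by fun_prop
    exact this
  set q : H → ℝ := fun x => b x x with hqdef
  have hbdd : BddBelow (q '' K) := ⟨0, by rintro _ ⟨x, -, rfl⟩; exact hpos x⟩
  set d := sInf (q '' K) with hd
  have hdle : ∀ x ∈ K, d ≤ q x := fun x hx => csInf_le hbdd ⟨x, hx, rfl⟩
  have hex : ∀ n : ℕ, ∃ x ∈ K, q x < d + 1 / ((n : ℝ) + 1) := by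
    intro n
    have hlt : d < d + 1 / ((n : ℝ) + 1) := lt_add_of_pos_right _ (by positivity)
    obtain ⟨_, ⟨x, hx, rfl⟩, h⟩ := exists_lt_of_csInf_lt (hne.image q) hlt
    exact ⟨x, hx, h⟩
  choose u huK hu using hex
  -- Parallelogram identity: the midpoint lies in K, so its value is at least d. This makes
  -- minimizing sequences Cauchy.
  have hpar : ∀ x ∈ K, ∀ y ∈ K, c * ‖x - y‖ ^ 2 ≤ 2 * q x + 2 * q y - 4 * d := by
    intro x hx y hy
    have hmid : (2⁻¹ : ℝ) • x + (2⁻¹ : ℝ) • y ∈ K :=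
      hconv hx hy (by norm_num) (by norm_num) (by norm_num)
    have h1 := hdle _ hmid
    have h2 := hlow (x - y)
    simp only [hqdef, map_add, map_sub, map_smul, LinearMap.add_apply, LinearMap.sub_apply,
      LinearMap.smul_apply, smul_eq_mul] at h1 h2 ⊢
    have := hsymm x y
    linarith
  have hcauchy : CauchySeq u := by
    refine cauchySeq_of_le_tendsto_0 (fun N : ℕ => Real.sqrt (4 / c * (1 / ((N : ℝ) + 1)))) ?_ ?_
    · intro n m N hn hm
      rw [dist_eq_norm]
      refine Real.le_sqrt_of_sq_le ?_
      have h1 := hpar _ (huK n) _ (huK m)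
      have h2 : 1 / ((n : ℝ) + 1) ≤ 1 / ((N : ℝ) + 1) :=
        one_div_le_one_div_of_le (by positivity) (by exact_mod_cast Nat.succ_le_succ hn)
      have h3 : 1 / ((m : ℝ) + 1) ≤ 1 / ((N : ℝ) + 1) :=
        one_div_le_one_div_of_le (by positivity) (by exact_mod_cast Nat.succ_le_succ hm)
      have h4 := hu n
      have h5 := hu m
      have h6 : c * ‖u n - u m‖ ^ 2 ≤ 4 * (1 / ((N : ℝ) + 1)) := by linarith
      rw [div_mul_eq_mul_div, le_div_iff₀ hc]
      linarith
    · have := (tendsto_one_div_add_atTop_nhds_zero_nat (𝕜 := ℝ)).const_mul (4 / c)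
      rw [mul_zero] at this
      have h2 := (Real.continuous_sqrt.tendsto 0).comp this
      rwa [Real.sqrt_zero] at h2
  obtain ⟨x, hx⟩ := cauchySeq_tendsto_of_complete hcauchy
  have hxK : x ∈ K := hclosed.mem_of_tendsto hx (.of_forall huK)
  have hqx : q x ≤ d := by
    refine le_of_tendsto_of_tendsto' ((hq.tendsto x).comp hx) ?_ (fun n => (hu n).le)
    simpa using (tendsto_one_div_add_atTop_nhds_zero_nat (𝕜 := ℝ)).const_add d
  refine ⟨x, hxK, fun y hy => ?_⟩
  by_contra! hneg
  set β := b x (y - x) with hβ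
  set Q := b (y - x) (y - x) with hQ
  have hQ0 : 0 ≤ Q := hpos _
  -- This step is short enough that 2β + tQ ≤ β - t < 0, so moving from x towards y would bring q
  -- below its infimum.
  set t : ℝ := min 1 (-β / (Q + 1)) with ht
  have ht0 : 0 < t := lt_min one_pos (div_pos (by linarith) (by linarith))
  have htQ : t * (Q + 1) ≤ -β := by
    rw [← le_div_iff₀ (by linarith)]
    exact min_le_right _ _
  have h1 := hdle _ (hconv.add_smul_sub_mem hxK hy ⟨ht0.le, min_le_left _ _⟩)
  have h2 : q (x + t • (y - x)) = q x + 2 * t * β + t * (t * Q) := by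
    rw [hβ, hQ]
    simp only [hqdef, map_add, map_smul, LinearMap.add_apply, LinearMap.smul_apply, smul_eq_mul]
    rw [hsymm (y - x) x]
    ring
  have h4 : 0 ≤ t * (2 * β + t * Q) := by linarith
  have h6 : 0 ≤ 2 * β + t * Q := nonneg_of_mul_nonneg_right h4 ht0
  linarith

/-! ### The truncated kernel and Schur's test -/

section CutKernel

variable {G : ℝ → ℝ} {T : ℝ}

/-- The kernel `x ↦ G |x|`, cut off to `0 < |x| ≤ T`. -/
noncomputable def cutKernel (G : ℝ → ℝ) (T x : ℝ) : ℝ := (Ioc 0 T).indicator G |x|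

lemma cutKernel_of_mem {x : ℝ} (hx : |x| ∈ Ioc 0 T) : cutKernel G T x = G |x| :=
  indicator_of_mem hx _

lemma cutKernel_neg (x : ℝ) : cutKernel G T (-x) = cutKernel G T x := by
  rw [cutKernel, abs_neg, cutKernel]

lemma cutKernel_sub_comm (x y : ℝ) : cutKernel G T (x - y) = cutKernel G T (y - x) := by
  rw [← cutKernel_neg, neg_sub]

lemma IsDecreasingKernel.cutKernel_nonneg (hG : IsDecreasingKernel G) (x : ℝ) :
    0 ≤ cutKernel G T x :=
  indicator_nonneg (fun t ht => hG.nonneg t ht.1) _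

lemma IsDecreasingKernel.integrable_cutKernel (hG : IsDecreasingKernel G) (hT : 0 < T) :
    Integrable (cutKernel G T) := by
  have h1 : Integrable ((Ioc 0 T).indicator G) :=
    (integrable_indicator_iff measurableSet_Ioc).2 (hG.integrableOn T hT)
  refine (h1.add h1.comp_neg).congr (.of_forall fun x => ?_)
  simp only [cutKernel, indicator_apply, mem_Ioc, Pi.add_apply]
  rcases lt_trichotomy x 0 with h | rfl | h
  · rw [abs_of_neg h, if_neg (by grind)]; simp
  · simp
  · rw [abs_of_pos h, if_neg (c := 0 < -x ∧ -x ≤ T) (by grind)]; simp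

lemma ae_prod_cutKernel_eq (G : ℝ → ℝ) (T : ℝ) :
    ∀ᵐ p : ℝ × ℝ ∂(lebesgueIcc T).prod (lebesgueIcc T),
      cutKernel G T (p.1 - p.2) = G |p.1 - p.2| := by
  filter_upwards [ae_prod_lebesgueIcc_abs_sub T] with p hp using cutKernel_of_mem hp

section Schur

variable {g A a b : ℝ → ℝ} {μ : Measure ℝ} [IsFiniteMeasure μ]

lemma integrable_kernel_mul_snd (hg : Integrable g) (hμ : μ ≤ volume) (hA : Integrable A μ) :
    Integrable (fun p : ℝ × ℝ => g (p.1 - p.2) * A p.2) (μ.prod μ) := by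
  have h := hA.convolution_integrand (ContinuousLinearMap.mul ℝ ℝ) hg
  refine (h.mono_measure (Measure.prod_mono hμ le_rfl)).congr (.of_forall fun p => ?_)
  simp [mul_comm]

lemma integral_kernel_mul_snd_le (hg : Integrable g) (hg0 : ∀ x, 0 ≤ g x) (hμ : μ ≤ volume)
    (hA : Integrable A μ) (hA0 : ∀ x, 0 ≤ A x) :
    ∫ p : ℝ × ℝ, g (p.1 - p.2) * A p.2 ∂(μ.prod μ) ≤ (∫ x, g x) * ∫ x, A x ∂μ := by
  rw [integral_prod_symm _ (integrable_kernel_mul_snd hg hμ hA), ← integral_const_mul]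
  refine integral_mono_of_nonneg (.of_forall fun y => integral_nonneg fun x =>
    mul_nonneg (hg0 _) (hA0 _)) (hA.const_mul _) (.of_forall fun y => ?_)
  simp only [integral_mul_const]
  refine mul_le_mul_of_nonneg_right ?_ (hA0 y)
  rw [← integral_sub_right_eq_self g y]
  exact integral_mono_measure hμ (.of_forall fun x => hg0 _) (hg.comp_sub_right y)

lemma integrable_kernel_mul_fst (hg : Integrable g) (heven : ∀ x, g (-x) = g x)
    (hμ : μ ≤ volume) (hA : Integrable A μ) :
    Integrable (fun p : ℝ × ℝ => g (p.1 - p.2) * A p.1) (μ.prod μ) := by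
  refine (integrable_kernel_mul_snd hg hμ hA).swap.congr (.of_forall fun p => ?_)
  simp only [Function.comp, Prod.fst_swap, Prod.snd_swap]
  rw [← heven, neg_sub]

/-- Schur's test: an integrable convolution kernel acts on `L²`. -/
lemma integrable_kernel_mul_mul (hg : Integrable g) (hg0 : ∀ x, 0 ≤ g x)
    (heven : ∀ x, g (-x) = g x) (hμ : μ ≤ volume) (ha : MemLp a 2 μ) (hb : MemLp b 2 μ) :
    Integrable (fun p : ℝ × ℝ => g (p.1 - p.2) * (a p.1 * b p.2)) (μ.prod μ) := by
  have hm : AEStronglyMeasurable (fun p : ℝ × ℝ => g (p.1 - p.2)) (μ.prod μ) := by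
    simpa using (integrable_kernel_mul_snd hg hμ (integrable_const (1 : ℝ))).1
  refine ((integrable_kernel_mul_fst hg heven hμ ha.integrable_sq).add
    (integrable_kernel_mul_snd hg hμ hb.integrable_sq)).mono'
    (hm.mul (ha.1.comp_fst.mul hb.1.comp_snd)) (.of_forall fun p => ?_)
  simp only [Pi.add_apply, norm_mul, Real.norm_of_nonneg (hg0 _), Real.norm_eq_abs]
  rw [← mul_add]
  refine mul_le_mul_of_nonneg_left ?_ (hg0 _)
  -- The crude bound |ab| ≤ a² + b² is enough for integrability.
  nlinarith [sq_nonneg (|a p.1| - |b p.2|), sq_abs (a p.1), sq_abs (b p.2), abs_nonneg (a p.1),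
    abs_nonneg (b p.2), mul_nonneg (abs_nonneg (a p.1)) (abs_nonneg (b p.2))]

/-- Bound a(t)a(s) by (a(t)² + a(s)²)/2; the two halves agree because g is even. This supplies the
upper bound on the energy form. -/
lemma integral_kernel_mul_self_le (hg : Integrable g) (hg0 : ∀ x, 0 ≤ g x)
    (heven : ∀ x, g (-x) = g x) (hμ : μ ≤ volume) (ha : MemLp a 2 μ) :
    ∫ p : ℝ × ℝ, g (p.1 - p.2) * (a p.1 * a p.2) ∂(μ.prod μ) ≤
      (∫ x, g x) * ∫ x, a x ^ 2 ∂μ := by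
  have h1 := integrable_kernel_mul_fst hg heven hμ ha.integrable_sq
  have h2 := integrable_kernel_mul_snd hg hμ ha.integrable_sq
  have hle : ∫ p : ℝ × ℝ, g (p.1 - p.2) * (a p.1 * a p.2) ∂(μ.prod μ) ≤
      ∫ p : ℝ × ℝ, 1 / 2 * (g (p.1 - p.2) * a p.1 ^ 2 + g (p.1 - p.2) * a p.2 ^ 2)
        ∂(μ.prod μ) := by
    refine integral_mono (integrable_kernel_mul_mul hg hg0 heven hμ ha ha)
      ((h1.add h2).const_mul _) fun p => ?_
    simp only
    rw [← mul_add, mul_left_comm (1 / 2)]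
    refine mul_le_mul_of_nonneg_left ?_ (hg0 _)
    nlinarith [sq_nonneg (a p.1 - a p.2)]
  have hsw : ∫ p : ℝ × ℝ, g (p.1 - p.2) * a p.1 ^ 2 ∂(μ.prod μ) =
      ∫ p : ℝ × ℝ, g (p.1 - p.2) * a p.2 ^ 2 ∂(μ.prod μ) := by
    rw [← integral_prod_swap]
    refine integral_congr_ae (.of_forall fun p => ?_)
    simp only [Prod.fst_swap, Prod.snd_swap]
    rw [← heven, neg_sub]
  rw [integral_const_mul, integral_add h1 h2, hsw] at hle
  have := integral_kernel_mul_snd_le hg hg0 hμ ha.integrable_sq fun x => sq_nonneg (a x)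
  linarith

end Schur

end CutKernel

/-! ### Potentials and the maximum principle -/

section Potential

variable {g φ : ℝ → ℝ} {μ : Measure ℝ} {M : ℝ}

lemma integrable_kernel_translate (hg : Integrable g) (hμ : μ ≤ volume)
    (hφ : AEStronglyMeasurable φ μ) (hM : ∀ᵐ s ∂μ, |φ s| ≤ M) (t : ℝ) :
    Integrable (fun s => g (t - s) * φ s) μ :=
  ((hg.comp_sub_left t).mono_measure hμ).mul_bdd hφ hM

/-- The potential of a bounded function under an integrable kernel is continuous. -/
lemma continuous_potential [IsFiniteMeasure μ] (hg : Integrable g) (hμ : μ ≤ volume)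
    (hφ : AEStronglyMeasurable φ μ) (hM : ∀ᵐ s ∂μ, |φ s| ≤ M) :
    Continuous fun t => ∫ s, g (t - s) * φ s ∂μ := by
  have hM' : ∀ᵐ s ∂μ, |φ s| ≤ max M 0 := hM.mono fun s hs => hs.trans (le_max_left _ _)
  refine continuous_of_uniform_approx_of_continuous fun V hV => ?_
  obtain ⟨ε, hε, hεV⟩ := Metric.mem_uniformity_dist.1 hV
  set N := max M 0 with hN
  have hN0 : 0 ≤ N := le_max_right _ _
  -- Approximating g in L¹ by continuous compactly supported k makes the potentials uniformly close,
  -- as φ is bounded by N.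
  obtain ⟨k, hkc, hk, hkcont, hki⟩ := hg.exists_hasCompactSupport_integral_sub_le
    (ε := ε / (2 * (N + 1))) (by positivity)
  obtain ⟨C, hC⟩ := hkcont.bounded_above_of_compact_support hkc
  refine ⟨fun t => ∫ s, k (t - s) * φ s ∂μ, ?_, fun t => hεV ?_⟩
  · refine continuous_of_dominated (bound := fun _ => C * N) (fun t => ?_) (fun t => ?_)
      (integrable_const _) ?_
    · exact (Continuous.aestronglyMeasurable (by fun_prop)).mul hφ
    · filter_upwards [hM'] with s hs
      rw [norm_mul]
      exact mul_le_mul (hC _) hs (norm_nonneg _) ((norm_nonneg _).trans (hC 0))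
    · exact .of_forall fun s => by fun_prop
  · have h1 := integrable_kernel_translate hg hμ hφ hM t
    have h2 := integrable_kernel_translate hki hμ hφ hM t
    have hd : Integrable fun s => g s - k s := hg.sub hki
    rw [dist_eq_norm, ← integral_sub h1 h2]
    calc ‖∫ s, (g (t - s) * φ s - k (t - s) * φ s) ∂μ‖
        ≤ ∫ s, ‖g (t - s) - k (t - s)‖ * N ∂μ := by
          refine norm_integral_le_of_norm_le
            (((hd.comp_sub_left t).mono_measure hμ).norm.mul_const N) ?_
          filter_upwards [hM'] with s hs
          rw [← sub_mul, norm_mul]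
          exact mul_le_mul_of_nonneg_left hs (norm_nonneg _)
      _ = (∫ s, ‖g (t - s) - k (t - s)‖ ∂μ) * N := integral_mul_const _ _
      _ ≤ (∫ s, ‖g s - k s‖) * N := by
          refine mul_le_mul_of_nonneg_right ?_ hN0
          rw [← integral_sub_left_eq_self (fun s => ‖g s - k s‖) volume t]
          exact integral_mono_measure hμ (.of_forall fun s => norm_nonneg _)
            (hd.comp_sub_left t).norm
      _ ≤ ε / (2 * (N + 1)) * N := mul_le_mul_of_nonneg_right hk hN0
      _ < ε := by
          rw [div_mul_eq_mul_div, div_lt_iff₀ (by positivity)]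
          nlinarith

end Potential

/-- The truncation vanishes at the origin, so monotonicity holds only away from it; hence `0 < |x|`.
-/
lemma cutKernel_le_of_lt {G : ℝ → ℝ} {T x y : ℝ} (hG : IsDecreasingKernel G) (hx : 0 < |x|)
    (hxy : |x| ≤ |y|) (hy : |y| ≤ T) : cutKernel G T y ≤ cutKernel G T x := by
  rw [cutKernel_of_mem ⟨hx, hxy.trans hy⟩, cutKernel_of_mem ⟨hx.trans_le hxy, hy⟩]
  exact hG.antitoneOn hx (hx.trans_le hxy) hxy

lemma cutKernel_convex_combination {G : ℝ → ℝ} {T x y α β : ℝ}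
    (hconv : ConvexOn ℝ (Ioc 0 T) G) (hx : x ∈ Ioc 0 T) (hy : y ∈ Ioc 0 T)
    (hα : 0 ≤ α) (hβ : 0 ≤ β) (hαβ : α + β = 1) :
    cutKernel G T (α * x + β * y) ≤ α * cutKernel G T x + β * cutKernel G T y := by
  have h : ∀ z ∈ Ioc 0 T, cutKernel G T z = G z := fun z hz => by
    rw [cutKernel_of_mem (by rwa [abs_of_pos hz.1]), abs_of_pos hz.1]
  have hz := hconv.1 hx hy hα hβ hαβ
  have := hconv.2 hx hy hα hβ hαβ
  simp only [smul_eq_mul] at hz this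
  rw [h _ hx, h _ hy, h _ hz]
  exact this

/-- **Maximum principle** for convex decreasing kernels: the potential of a nonnegative bounded
function that is at most `c` on its support is at most `c` everywhere. -/
lemma potential_le_of_le_on_support {G φ : ℝ → ℝ} {T M c : ℝ} (hT : 0 < T)
    (hG : IsDecreasingKernel G) (hconv : ConvexOn ℝ (Ioc 0 T) G)
    (hφ : AEStronglyMeasurable φ (lebesgueIcc T)) (hφ0 : ∀ᵐ s ∂(lebesgueIcc T), 0 ≤ φ s)
    (hφM : ∀ᵐ s ∂(lebesgueIcc T), |φ s| ≤ M) (hne : ¬ φ =ᵐ[lebesgueIcc T] 0)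
    (hsupp : ∀ᵐ s ∂(lebesgueIcc T), φ s ≠ 0 →
      ∫ r, cutKernel G T (s - r) * φ r ∂(lebesgueIcc T) ≤ c) {t : ℝ} (ht : t ∈ Icc 0 T) :
    ∫ s, cutKernel G T (t - s) * φ s ∂(lebesgueIcc T) ≤ c := by
  set μ := lebesgueIcc T with hμdef
  have hμ : μ ≤ volume := Measure.restrict_le_self
  have hg := hG.integrable_cutKernel hT
  set f : ℝ → ℝ := fun t => ∫ s, cutKernel G T (t - s) * φ s ∂μ with hf
  have hfc : Continuous f := continuous_potential hg hμ hφ hφM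
  have hi : ∀ r, Integrable (fun s => cutKernel G T (r - s) * φ s) μ := fun r =>
    integrable_kernel_translate hg hμ hφ hφM r
  have hmem : ∀ᵐ s ∂μ, s ∈ Icc 0 T := ae_restrict_mem measurableSet_Icc
  change f t ≤ c
  by_contra! hlt
  have hLc : IsCompact (Icc 0 t ∩ {r | f r ≤ c}) :=
    isCompact_Icc.inter_right (isClosed_le hfc continuous_const)
  have hRc : IsCompact (Icc t T ∩ {r | f r ≤ c}) :=
    isCompact_Icc.inter_right (isClosed_le hfc continuous_const)
  -- Suppose f t > c. Let a be the last point left of t with f ≤ c, and b the first such point right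
  -- of t, when they exist. As f > c forces φ = 0, φ vanishes on the gap around t.
  have hL : (∀ r ∈ Icc 0 t, c < f r) ∨
      ∃ a ∈ Icc 0 t, f a ≤ c ∧ ∀ r ∈ Ioc a t, c < f r := by
    rcases (Icc 0 t ∩ {r | f r ≤ c}).eq_empty_or_nonempty with h | h
    · refine .inl fun r hr => not_le.1 fun hc => ?_
      exact (h ▸ (⟨hr, hc⟩ : r ∈ Icc 0 t ∩ {r | f r ≤ c}) : r ∈ (∅ : Set ℝ))
    · obtain ⟨a, ha, hmax⟩ := hLc.exists_isGreatest h
      refine .inr ⟨a, ha.1, ha.2, fun r hr => not_le.1 fun hc => ?_⟩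
      exact absurd (hmax ⟨⟨ha.1.1.trans hr.1.le, hr.2⟩, hc⟩) (not_le.2 hr.1)
  have hR : (∀ r ∈ Icc t T, c < f r) ∨
      ∃ b ∈ Icc t T, f b ≤ c ∧ ∀ r ∈ Ico t b, c < f r := by
    rcases (Icc t T ∩ {r | f r ≤ c}).eq_empty_or_nonempty with h | h
    · refine .inl fun r hr => not_le.1 fun hc => ?_
      exact (h ▸ (⟨hr, hc⟩ : r ∈ Icc t T ∩ {r | f r ≤ c}) : r ∈ (∅ : Set ℝ))
    · obtain ⟨b, hb, hmin⟩ := hRc.exists_isLeast h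
      refine .inr ⟨b, hb.1, hb.2, fun r hr => not_le.1 fun hc => ?_⟩
      exact absurd (hmin ⟨⟨hr.1, hr.2.le.trans hb.1.2⟩, hc⟩) (not_le.2 hr.2)
  have hzero : ∀ᵐ s ∂μ, c < f s → φ s = 0 := by
    filter_upwards [hsupp] with s hs hcs
    by_contra h0
    exact absurd (hs h0) (not_le.2 hcs)
  rcases hL with hL | ⟨a, ha, hfa, hLa⟩ <;> rcases hR with hR | ⟨b, hb, hfb, hRb⟩
  -- Neither endpoint exists: φ vanishes almost everywhere.
  · refine hne ?_
    filter_upwards [hzero, hmem] with s hs hsm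
    rcases le_total s t with h | h
    · exact hs (hL s ⟨hsm.1, h⟩)
    · exact hs (hR s ⟨h, hsm.2⟩)
  -- Only b exists: φ lives to the right of b, and b is closer than t to every such s, so f t ≤ f b
  -- ≤ c. The next case is the mirror image.
  · refine absurd hfb (not_le.2 (hlt.trans_le (integral_mono_ae (hi t) (hi b) ?_)))
    filter_upwards [hzero, hmem, hφ0, Measure.ae_ne μ b] with s hs hsm h0 hsb
    rcases lt_or_gt_of_ne hsb with h | h
    · have : φ s = 0 := hs <| by
        rcases le_total s t with h' | h'
        · exact hL s ⟨hsm.1, h'⟩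
        · exact hRb s ⟨h', h⟩
      simp [this]
    · refine mul_le_mul_of_nonneg_right ?_ h0
      have h1 : |b - s| = s - b := by rw [abs_of_neg (by linarith)]; ring
      have h2 : |t - s| = s - t := by rw [abs_of_neg (by linarith [hb.1])]; ring
      refine cutKernel_le_of_lt hG ?_ ?_ ?_
      · linarith
      · linarith [hb.1]
      · linarith [hsm.2, ht.1]
  · refine absurd hfa (not_le.2 (hlt.trans_le (integral_mono_ae (hi t) (hi a) ?_)))
    filter_upwards [hzero, hmem, hφ0, Measure.ae_ne μ a] with s hs hsm h0 hsa
    rcases lt_or_gt_of_ne hsa with h | h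
    · refine mul_le_mul_of_nonneg_right ?_ h0
      have h1 : |a - s| = a - s := abs_of_pos (by linarith)
      have h2 : |t - s| = t - s := abs_of_pos (by linarith [ha.2])
      refine cutKernel_le_of_lt hG ?_ ?_ ?_
      · linarith
      · linarith [ha.2]
      · linarith [hsm.1, ht.2]
    · have : φ s = 0 := hs <| by
        rcases le_total s t with h' | h'
        · exact hLa s ⟨h, h'⟩
        · exact hR s ⟨h', hsm.2⟩
      simp [this]
  -- Both exist: for s outside [a,b] the kernel centred at s is convex on [a,b], so f t is at most
  -- the corresponding convex combination of f a and f b.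
  · have hat : a < t := lt_of_le_of_ne ha.2 (by rintro rfl; exact absurd hfa (not_le.2 hlt))
    have htb : t < b := lt_of_le_of_ne hb.1 (by rintro rfl; exact absurd hfb (not_le.2 hlt))
    have hab : 0 < b - a := by linarith
    set α := (b - t) / (b - a) with hα
    set β := (t - a) / (b - a) with hβ
    have hα0 : 0 ≤ α := div_nonneg (by linarith) hab.le
    have hβ0 : 0 ≤ β := div_nonneg (by linarith) hab.le
    have hαβ : α + β = 1 := by
      rw [hα, hβ, ← add_div, div_eq_one_iff_eq hab.ne']; ring
    have htc : t = α * a + β * b := by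
      rw [hα, hβ]; field_simp; ring
    have hcomb : f t ≤ α * f a + β * f b := by
      simp only [hf]
      rw [← integral_const_mul, ← integral_const_mul,
        ← integral_add ((hi a).const_mul _) ((hi b).const_mul _)]
      refine integral_mono_ae (hi t) (((hi a).const_mul _).add ((hi b).const_mul _)) ?_
      filter_upwards [hzero, hmem, hφ0, Measure.ae_ne μ a, Measure.ae_ne μ b] with s hs hsm h0 ha' hb'
      rw [← mul_assoc, ← mul_assoc, ← add_mul]
      rcases lt_or_gt_of_ne ha' with h | h
      · refine mul_le_mul_of_nonneg_right ?_ h0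
        have : t - s = α * (a - s) + β * (b - s) := by
          rw [htc]; linear_combination s * hαβ
        rw [this]
        refine cutKernel_convex_combination hconv ⟨?_, ?_⟩ ⟨?_, ?_⟩ hα0 hβ0 hαβ
        all_goals linarith [hsm.1, ha.2, hb.2, ht.2]
      · rcases lt_or_gt_of_ne hb' with h' | h'
        · have : φ s = 0 := hs <| by
            rcases le_total s t with h'' | h''
            · exact hLa s ⟨h, h''⟩
            · exact hRb s ⟨h'', h'⟩
          simp [this]
        · refine mul_le_mul_of_nonneg_right ?_ h0
          rw [cutKernel_sub_comm t, cutKernel_sub_comm a, cutKernel_sub_comm b]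
          have : s - t = α * (s - a) + β * (s - b) := by
            rw [htc]; linear_combination (-s) * hαβ
          rw [this]
          refine cutKernel_convex_combination hconv ⟨?_, ?_⟩ ⟨?_, ?_⟩ hα0 hβ0 hαβ
          all_goals linarith [hsm.2, ha.1, hb.1, ht.1]
    have h1 := mul_le_mul_of_nonneg_left hfa hα0
    have h2 := mul_le_mul_of_nonneg_left hfb hβ0
    have h3 : α * c + β * c = c := by rw [← add_mul, hαβ, one_mul]
    linarith

/-! ### The energy as a bilinear form on L² -/

section EnergyForm

variable {G : ℝ → ℝ} {T γ : ℝ}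

lemma lebesgueIcc_le_volume (T : ℝ) : lebesgueIcc T ≤ volume := Measure.restrict_le_self

lemma IsDecreasingKernel.integrable_cutKernel_mul_mul (hG : IsDecreasingKernel G) (hT : 0 < T)
    (φ ψ : L2Icc T) :
    Integrable (fun p : ℝ × ℝ => cutKernel G T (p.1 - p.2) * (φ p.1 * ψ p.2))
      ((lebesgueIcc T).prod (lebesgueIcc T)) :=
  integrable_kernel_mul_mul (hG.integrable_cutKernel hT) hG.cutKernel_nonneg cutKernel_neg
    (lebesgueIcc_le_volume T) (Lp.memLp φ) (Lp.memLp ψ)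

/-- The interaction form `∫∫ G(|t-s|) φ(t) ψ(s) dt ds`. -/
noncomputable def interaction (G : ℝ → ℝ) (T : ℝ) (φ ψ : L2Icc T) : ℝ :=
  ∫ p : ℝ × ℝ, cutKernel G T (p.1 - p.2) * (φ p.1 * ψ p.2) ∂((lebesgueIcc T).prod (lebesgueIcc T))

lemma interaction_comm (φ ψ : L2Icc T) : interaction G T φ ψ = interaction G T ψ φ := by
  rw [interaction, interaction, ← integral_prod_swap]
  refine integral_congr_ae (.of_forall fun p => ?_)
  simp only [Prod.fst_swap, Prod.snd_swap]
  rw [cutKernel_sub_comm, mul_comm (φ _)]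

lemma interaction_add_left (hG : IsDecreasingKernel G) (hT : 0 < T) (φ φ' ψ : L2Icc T) :
    interaction G T (φ + φ') ψ = interaction G T φ ψ + interaction G T φ' ψ := by
  rw [interaction, interaction, interaction, ← integral_add
    (hG.integrable_cutKernel_mul_mul hT φ ψ) (hG.integrable_cutKernel_mul_mul hT φ' ψ)]
  refine integral_congr_ae ?_
  filter_upwards [Measure.quasiMeasurePreserving_fst.ae (Lp.coeFn_add φ φ')] with p hp
  rw [hp, Pi.add_apply]
  ring

lemma interaction_smul_left (c : ℝ) (φ ψ : L2Icc T) :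
    interaction G T (c • φ) ψ = c * interaction G T φ ψ := by
  rw [interaction, interaction, ← integral_const_mul]
  refine integral_congr_ae ?_
  filter_upwards [Measure.quasiMeasurePreserving_fst.ae (Lp.coeFn_smul c φ)] with p hp
  rw [hp, Pi.smul_apply, smul_eq_mul]
  ring

/-- The bilinear form whose quadratic form is twice the energy. -/
noncomputable def energyForm (γ : ℝ) (hG : IsDecreasingKernel G) (hT : 0 < T) :
    LinearMap.BilinForm ℝ (L2Icc T) :=
  LinearMap.mk₂ ℝ (fun φ ψ => γ * inner ℝ φ ψ + interaction G T φ ψ)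
    (fun φ φ' ψ => by rw [inner_add_left, interaction_add_left hG hT]; ring)
    (fun c φ ψ => by
      rw [real_inner_smul_left, interaction_smul_left, smul_eq_mul]; ring)
    (fun φ ψ ψ' => by
      rw [inner_add_right, interaction_comm, interaction_add_left hG hT, interaction_comm ψ,
        interaction_comm ψ']
      ring)
    (fun c φ ψ => by
      rw [real_inner_smul_right, interaction_comm, interaction_smul_left, interaction_comm ψ,
        smul_eq_mul]
      ring)

lemma energyForm_apply (γ : ℝ) (hG : IsDecreasingKernel G) (hT : 0 < T) (φ ψ : L2Icc T) :
    energyForm γ hG hT φ ψ = γ * inner ℝ φ ψ + interaction G T φ ψ := rfl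

lemma energyForm_comm (γ : ℝ) (hG : IsDecreasingKernel G) (hT : 0 < T) (φ ψ : L2Icc T) :
    energyForm γ hG hT φ ψ = energyForm γ hG hT ψ φ := by
  rw [energyForm_apply, energyForm_apply, real_inner_comm, interaction_comm]

lemma L2Icc_inner (φ ψ : L2Icc T) : inner ℝ φ ψ = ∫ t, φ t * ψ t ∂(lebesgueIcc T) := by
  rw [L2.inner_def]
  refine integral_congr_ae (.of_forall fun t => ?_)
  simp [mul_comm]

lemma interaction_eq (φ ψ : L2Icc T) :
    interaction G T φ ψ = ∫ p : ℝ × ℝ, G |p.1 - p.2| * (φ p.1 * ψ p.2)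
      ∂((lebesgueIcc T).prod (lebesgueIcc T)) := by
  refine integral_congr_ae ?_
  filter_upwards [ae_prod_cutKernel_eq G T] with p hp
  rw [hp]

lemma integrable_kernel_mul_mul_L2Icc (hG : IsDecreasingKernel G) (hT : 0 < T) (φ ψ : L2Icc T) :
    Integrable (fun p : ℝ × ℝ => G |p.1 - p.2| * (φ p.1 * ψ p.2))
      ((lebesgueIcc T).prod (lebesgueIcc T)) := by
  refine (hG.integrable_cutKernel_mul_mul hT φ ψ).congr ?_
  filter_upwards [ae_prod_cutKernel_eq G T] with p hp
  rw [hp]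

lemma L2Icc_integrable (φ : L2Icc T) : Integrable φ (lebesgueIcc T) :=
  (Lp.memLp φ).integrable (by norm_num)

lemma interaction_self_nonneg (hG : IsDecreasingKernel G) (hT : 0 < T)
    (hconv : ConvexOn ℝ (Ioc 0 T) G) (φ : L2Icc T) : 0 ≤ interaction G T φ φ := by
  rw [interaction_eq]
  exact integral_convex_kernel_nonneg (hG.continuousOn.mono Ioc_subset_Ioi_self)
    (hG.antitoneOn.mono Ioc_subset_Ioi_self) hconv (hG.nonneg T hT) (L2Icc_integrable φ)
    (integrable_kernel_mul_mul_L2Icc hG hT φ φ)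

lemma le_energyForm_self (γ : ℝ) (hG : IsDecreasingKernel G) (hT : 0 < T)
    (hconv : ConvexOn ℝ (Ioc 0 T) G) (φ : L2Icc T) : γ * ‖φ‖ ^ 2 ≤ energyForm γ hG hT φ φ := by
  rw [energyForm_apply, real_inner_self_eq_norm_sq]
  exact le_add_of_nonneg_right (interaction_self_nonneg hG hT hconv φ)

lemma energyForm_self_le (γ : ℝ) (hG : IsDecreasingKernel G) (hT : 0 < T) (φ : L2Icc T) :
    energyForm γ hG hT φ φ ≤ (γ + ∫ x, cutKernel G T x) * ‖φ‖ ^ 2 := by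
  have h := integral_kernel_mul_self_le (hG.integrable_cutKernel hT) hG.cutKernel_nonneg
    cutKernel_neg (lebesgueIcc_le_volume T) (Lp.memLp φ)
  have h2 : ∫ t, φ t ^ 2 ∂(lebesgueIcc T) = ‖φ‖ ^ 2 := by
    rw [← real_inner_self_eq_norm_sq, L2Icc_inner]
    simp only [sq]
  rw [h2] at h
  rw [energyForm_apply, real_inner_self_eq_norm_sq, add_mul]
  exact add_le_add le_rfl h

lemma energy_eq_energyForm (γ : ℝ) (hG : IsDecreasingKernel G) (hT : 0 < T) (φ : L2Icc T) :
    energy γ T G φ = 1 / 2 * energyForm γ hG hT φ φ := by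
  have h := integrable_kernel_mul_mul_L2Icc hG hT φ φ
  have h2 : interaction G T φ φ =
      ∫ s in Icc 0 T, (∫ t in Icc 0 T, G |t - s| * φ t * φ s) := by
    rw [interaction_eq, integral_prod_symm _ h]
    simp only [mul_assoc]
  rw [energy, energyForm_apply, L2Icc_inner, h2]
  simp only [sq]
  ring

/-- The integrability requirement in `constraintSet` is automatic. -/
lemma mem_constraintSet_iff (hG : IsDecreasingKernel G) (hT : 0 < T) (φ : L2Icc T) :
    φ ∈ constraintSet T G ↔ ∫ t, φ t ∂(lebesgueIcc T) = 1 := by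
  refine ⟨fun h => h.1, fun h => ⟨h, ?_⟩⟩
  simpa only [mul_assoc] using integrable_kernel_mul_mul_L2Icc hG hT φ φ

/-! ### First variation and the Euler-Lagrange equation -/

/-- The first variation `γ φ(t) + ∫ G(|t-s|) φ(s) ds` of the energy. -/
noncomputable def energyGradient (γ : ℝ) (G : ℝ → ℝ) (T : ℝ) (φ : L2Icc T) (t : ℝ) : ℝ :=
  γ * φ t + ∫ s, cutKernel G T (t - s) * φ s ∂(lebesgueIcc T)

lemma integrable_potential (hG : IsDecreasingKernel G) (hT : 0 < T) (φ : L2Icc T) :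
    Integrable (fun t => ∫ s, cutKernel G T (t - s) * φ s ∂(lebesgueIcc T)) (lebesgueIcc T) :=
  (integrable_kernel_mul_snd (hG.integrable_cutKernel hT) (lebesgueIcc_le_volume T)
    (L2Icc_integrable φ)).integral_prod_left

lemma integrable_energyGradient (hG : IsDecreasingKernel G) (hT : 0 < T) (φ : L2Icc T) :
    Integrable (energyGradient γ G T φ) (lebesgueIcc T) :=
  ((L2Icc_integrable φ).const_mul γ).add (integrable_potential hG hT φ)

lemma integrable_energyGradient_mul (hG : IsDecreasingKernel G) (hT : 0 < T) (φ ψ : L2Icc T) :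
    Integrable (fun t => energyGradient γ G T φ t * ψ t) (lebesgueIcc T) ∧
    energyForm γ hG hT φ ψ = ∫ t, energyGradient γ G T φ t * ψ t ∂(lebesgueIcc T) := by
  have hp := hG.integrable_cutKernel_mul_mul hT ψ φ
  have h1 : Integrable (fun t => γ * (φ t * ψ t)) (lebesgueIcc T) :=
    ((Lp.memLp φ).integrable_mul (Lp.memLp ψ)).const_mul γ
  have he : ∀ t, ∫ s, cutKernel G T (t - s) * (ψ t * φ s) ∂(lebesgueIcc T) =
      (∫ s, cutKernel G T (t - s) * φ s ∂(lebesgueIcc T)) * ψ t := fun t => by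
    rw [← integral_mul_const]
    refine integral_congr_ae (.of_forall fun s => ?_)
    simp only
    ring
  have h2 := hp.integral_prod_left
  simp only [he] at h2
  have hs : (fun t => energyGradient γ G T φ t * ψ t) = fun t => γ * (φ t * ψ t) +
      (∫ s, cutKernel G T (t - s) * φ s ∂(lebesgueIcc T)) * ψ t := by
    funext t
    rw [energyGradient]
    ring
  rw [hs]
  refine ⟨h1.add h2, ?_⟩
  rw [integral_add h1 h2, energyForm_apply, interaction_comm, interaction, integral_prod _ hp,
    L2Icc_inner, integral_const_mul]
  simp only [he]

/-- The nonnegative elements of `L²[0,T]` with integral `1`. -/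
def densitySet (T : ℝ) : Set (L2Icc T) :=
  {φ | 0 ≤ φ ∧ ∫ t, φ t ∂(lebesgueIcc T) = 1}

/-- Pairing with the constant 1 shows that the integral is a continuous linear functional, as
closedness and convexity of the density set require. -/
lemma L2Icc_integral_eq_inner (φ : L2Icc T) :
    ∫ t, φ t ∂(lebesgueIcc T) =
      inner ℝ (indicatorConstLp 2 MeasurableSet.univ (measure_ne_top (lebesgueIcc T) _) (1 : ℝ)) φ := by
  rw [L2.inner_indicatorConstLp_one, setIntegral_univ]

lemma isClosed_densitySet (T : ℝ) : IsClosed (densitySet T) := by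
  refine IsClosed.inter (isClosed_Ici (a := (0 : L2Icc T))) ?_
  simp only [L2Icc_integral_eq_inner]
  exact isClosed_eq (by fun_prop) continuous_const

lemma convex_densitySet (T : ℝ) : Convex ℝ (densitySet T) := by
  intro φ hφ ψ hψ a b ha hb hab
  refine ⟨?_, ?_⟩
  · have h1 := Lp.coeFn_nonneg φ |>.2 hφ.1
    have h2 := Lp.coeFn_nonneg ψ |>.2 hψ.1
    refine (Lp.coeFn_nonneg _).1 ?_
    filter_upwards [h1, h2, Lp.coeFn_add (a • φ) (b • ψ), Lp.coeFn_smul a φ, Lp.coeFn_smul b ψ]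
      with t h1 h2 h3 h4 h5
    rw [h3, Pi.add_apply, h4, h5]
    exact add_nonneg (mul_nonneg ha h1) (mul_nonneg hb h2)
  · have h1 := hφ.2
    have h2 := hψ.2
    rw [L2Icc_integral_eq_inner] at h1 h2 ⊢
    rw [inner_add_right, real_inner_smul_right, real_inner_smul_right, h1, h2]
    linarith

/-- Normalized indicators are densities. -/
lemma exists_mem_densitySet {T : ℝ} {s : Set ℝ} (hs : MeasurableSet s)
    (hpos : 0 < (lebesgueIcc T).real s) :
    ∃ ψ ∈ densitySet T, ψ =ᵐ[lebesgueIcc T] s.indicator fun _ => ((lebesgueIcc T).real s)⁻¹ := by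
  set m := (lebesgueIcc T).real s
  refine ⟨indicatorConstLp 2 hs (measure_ne_top _ _) m⁻¹, ⟨?_, ?_⟩, indicatorConstLp_coeFn⟩
  · refine (Lp.coeFn_nonneg _).1 ?_
    filter_upwards [indicatorConstLp_coeFn (p := 2) (hs := hs)
      (hμs := measure_ne_top (lebesgueIcc T) _) (c := m⁻¹)] with t ht
    rw [ht]
    exact indicator_nonneg (fun _ _ => inv_nonneg.2 hpos.le) _
  · rw [integral_congr_ae indicatorConstLp_coeFn, integral_indicator_const _ hs, smul_eq_mul]
    exact mul_inv_cancel₀ hpos.ne'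

lemma densitySet_nonempty (hT : 0 < T) : (densitySet T).Nonempty := by
  obtain ⟨ψ, hψ, -⟩ := exists_mem_densitySet (T := T) MeasurableSet.univ (by simp [hT])
  exact ⟨ψ, hψ⟩

/-- A density at which the energy has nonnegative first variation among densities satisfies the
Euler-Lagrange equation on all of `[0,T]`. -/
lemma energyGradient_ae_eq_const (hγ : 0 < γ) (hT : 0 < T) (hG : IsDecreasingKernel G)
    (hconv : ConvexOn ℝ (Ioc 0 T) G) {φ : L2Icc T} (hφ : φ ∈ densitySet T)
    (hvar : ∀ ψ ∈ densitySet T, 0 ≤ energyForm γ hG hT φ (ψ - φ)) :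
    ∃ c, ∀ᵐ t ∂(lebesgueIcc T), energyGradient γ G T φ t = c := by
  set c := energyForm γ hG hT φ φ with hc
  set w := energyGradient γ G T φ with hw
  have hwi : Integrable w (lebesgueIcc T) := integrable_energyGradient hG hT φ
  have hφ0 : ∀ᵐ t ∂(lebesgueIcc T), 0 ≤ φ t := (Lp.coeFn_nonneg φ).2 hφ.1
  -- Testing the variational inequality with normalized indicators shows that every average of w is
  -- at least c.
  have hge : ∀ᵐ t ∂(lebesgueIcc T), c ≤ w t := by
    refine ae_le_of_forall_setIntegral_le (integrable_const c) hwi fun s hs _ => ?_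
    rcases (measureReal_nonneg (μ := lebesgueIcc T) (s := s)).eq_or_lt with h0 | hpos
    · rw [eq_comm, measureReal_eq_zero_iff] at h0
      rw [setIntegral_measure_zero _ h0, setIntegral_measure_zero _ h0]
    · obtain ⟨ψ, hψ, hψs⟩ := exists_mem_densitySet hs hpos
      have h1 := hvar ψ hψ
      rw [map_sub, sub_nonneg, (integrable_energyGradient_mul hG hT φ ψ).2] at h1
      have h2 : ∫ t, w t * ψ t ∂(lebesgueIcc T) =
          (∫ t in s, w t ∂(lebesgueIcc T)) * ((lebesgueIcc T).real s)⁻¹ := by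
        rw [← integral_mul_const, ← integral_indicator hs]
        refine integral_congr_ae ?_
        filter_upwards [hψs] with t ht
        rw [ht]
        by_cases hts : t ∈ s <;> simp [hts]
      rw [h2, ← div_eq_mul_inv, le_div_iff₀ hpos] at h1
      simpa [mul_comm] using h1
  -- Complementary slackness: the integrand is nonnegative, and its integral is B(φ,φ) - c ∫ φ = 0.
  have hcompl : ∀ᵐ t ∂(lebesgueIcc T), (w t - c) * φ t = 0 := by
    have hi : Integrable (fun t => (w t - c) * φ t) (lebesgueIcc T) := by
      simp only [sub_mul]
      exact (integrable_energyGradient_mul hG hT φ φ).1.sub ((L2Icc_integrable φ).const_mul c)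
    have hnn : 0 ≤ᵐ[lebesgueIcc T] fun t => (w t - c) * φ t := by
      filter_upwards [hge, hφ0] with t h1 h2 using mul_nonneg (sub_nonneg.2 h1) h2
    refine (integral_eq_zero_iff_of_nonneg_ae hnn hi).1 ?_
    simp only [sub_mul]
    rw [integral_sub (integrable_energyGradient_mul hG hT φ φ).1
      ((L2Icc_integrable φ).const_mul c), ← (integrable_energyGradient_mul hG hT φ φ).2,
      integral_const_mul, hφ.2, ← hc]
    ring
  have hpot0 : ∀ t, 0 ≤ ∫ s, cutKernel G T (t - s) * φ s ∂(lebesgueIcc T) := fun t => by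
    refine integral_nonneg_of_ae ?_
    filter_upwards [hφ0] with s hs using mul_nonneg (hG.cutKernel_nonneg _) hs
  have hc0 : 0 ≤ c := le_trans (by positivity) (le_energyForm_self γ hG hT hconv φ)
  have hwc : ∀ᵐ t ∂(lebesgueIcc T), φ t ≠ 0 → w t = c := by
    filter_upwards [hcompl] with t ht h0
    exact sub_eq_zero.1 ((mul_eq_zero.1 ht).resolve_right h0)
  -- Where φ ≠ 0, γφ = c - potential ≤ c. The maximum principle needs this boundedness, as φ is so
  -- far only in L².
  have hbound : ∀ᵐ t ∂(lebesgueIcc T), |φ t| ≤ c / γ := by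
    filter_upwards [hwc, hφ0] with t h1 h2
    rw [abs_of_nonneg h2]
    by_cases h0 : φ t = 0
    · rw [h0]; positivity
    · have h3 := h1 h0
      rw [hw, energyGradient] at h3
      rw [le_div_iff₀ hγ]
      linarith [hpot0 t]
  have hne : ¬ φ =ᵐ[lebesgueIcc T] 0 := fun h => by
    have h1 := hφ.2
    rw [integral_congr_ae h] at h1
    simp at h1
  have hmax := fun t ht => potential_le_of_le_on_support (t := t) (c := c) hT hG hconv
    (Lp.aestronglyMeasurable φ) hφ0 hbound hne ?_ ht
  · refine ⟨c, ?_⟩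
    filter_upwards [hwc, hge, ae_restrict_mem measurableSet_Icc] with t h1 h2 ht
    by_cases h0 : φ t = 0
    · refine le_antisymm ?_ h2
      rw [hw, energyGradient, h0, mul_zero, zero_add]
      exact hmax t ht
    · exact h1 h0
  -- On the support the potential equals c - γφ ≤ c.
  · filter_upwards [hwc, hφ0] with t h1 h2 h0
    have h3 := h1 h0
    rw [hw, energyGradient] at h3
    linarith [mul_nonneg hγ.le h2]

end EnergyForm

/-! ### Existence, uniqueness and positivity of the minimizer -/

theorem proposition2p1 (γ T : ℝ) (hγ : 0 < γ) (hT : 0 < T) (G : ℝ → ℝ)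
    (hG : IsDecreasingKernel G) (hconv : ConvexOn ℝ (Ioc 0 T) G) :
    (∃! φ : L2Icc T, IsEnergyMinimizer γ T G φ) ∧
      ∀ φ : L2Icc T, IsEnergyMinimizer γ T G φ → IsProbabilityDensity T φ := by
  obtain ⟨φ, hφ, hvar⟩ := exists_variational_inequality (energyForm γ hG hT)
    (energyForm_comm γ hG hT) hγ (le_energyForm_self γ hG hT hconv) (energyForm_self_le γ hG hT)
    (densitySet_nonempty hT) (isClosed_densitySet T) (convex_densitySet T)
  obtain ⟨c, hc⟩ := energyGradient_ae_eq_const hγ hT hG hconv hφ hvar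
  have hform : ∀ ψ : L2Icc T, energyForm γ hG hT φ ψ = c * ∫ t, ψ t ∂(lebesgueIcc T) := by
    intro ψ
    rw [(integrable_energyGradient_mul hG hT φ ψ).2, ← integral_const_mul]
    refine integral_congr_ae ?_
    filter_upwards [hc] with t ht
    rw [ht]
  -- Since B(φ,ψ) = c = B(φ,φ) for every ψ of integral 1, B(ψ-φ,ψ-φ) = B(ψ,ψ) - B(φ,φ); coercivity
  -- bounds this below and so yields uniqueness too.
  have hgrowth : ∀ ψ ∈ constraintSet T G,
      energy γ T G φ + γ / 2 * ‖ψ - φ‖ ^ 2 ≤ energy γ T G ψ := by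
    intro ψ hψ
    have h1 := hform ψ
    have h2 := hform φ
    rw [hψ.1] at h1
    rw [hφ.2] at h2
    have h3 := le_energyForm_self γ hG hT hconv (ψ - φ)
    rw [map_sub, map_sub, LinearMap.sub_apply, LinearMap.sub_apply,
      energyForm_comm γ hG hT ψ φ] at h3
    rw [energy_eq_energyForm γ hG hT, energy_eq_energyForm γ hG hT]
    linarith
  have hmin : IsEnergyMinimizer γ T G φ :=
    ⟨(mem_constraintSet_iff hG hT φ).2 hφ.2, fun ψ hψ =>
      (le_add_of_nonneg_right (by positivity)).trans (hgrowth ψ hψ)⟩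
  have huniq : ∀ ψ, IsEnergyMinimizer γ T G ψ → ψ = φ := by
    intro ψ hψ
    have h1 := hgrowth ψ hψ.1
    have h2 := hψ.2 φ hmin.1
    have h3 : ‖ψ - φ‖ ^ 2 ≤ 0 := by
      by_contra! h
      have := mul_pos (half_pos hγ) h
      linarith
    have h4 : ‖ψ - φ‖ = 0 := pow_eq_zero_iff two_ne_zero |>.1 (le_antisymm h3 (sq_nonneg _))
    exact sub_eq_zero.1 (norm_eq_zero.1 h4)
  refine ⟨⟨φ, hmin, huniq⟩, fun ψ hψ => ?_⟩
  rw [huniq ψ hψ]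
  exact ⟨(Lp.coeFn_nonneg φ).2 hφ.1, L2Icc_integrable φ, hφ.2⟩
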